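/- Let $\mathcal{C}$ be an *arithmetical category*: a Barr exact Mal'tsev category in which every internal groupoid is an equivalence relation. (Mal'tsev means: finitely complete, and every internal reflexive relation is an equivalence relation.) Two equivalence relations $R$, $S$ on an object $X$ *centralise each other* if there is a connector between them, that is, a morphism $p\colon R\times_X S\to X$, defined on triples $(x,y,z)$ with $xRy$ and $ySz$, such that $x\,S\,p(x,y,z)$, $z\,R\,p(x,y,z)$, $p(x,x,z)=z$, $p(x,y,y)=x$, $p(x,y,p(y,t,w))=p(x,t,w)$ and $p(p(x,y,t),t,w)=p(x,y,w)$ whenever these expressions are defined. Their *Smith commutator* $[R,S]^{\mathrm S}$ is the smallest equivalence relation $T$ on $X$ such that the images of $R$ and $S$ in the quotient $X/T$ centralise each other. 1. For any two equivalence relations $R$, $S$ on an object of $\mathcal{C}$, the Smith commutator exists and $[R,S]^{\mathrm S}=R\wedge S$. 2. Suppose that $\mathcal{C}$ is moreover pointed. Two morphisms $k\colon K\to D$, $l\colon L\to D$ *Huq-commute* if there is $\varphi\colon K\times L\to D$ with $\varphi\circ\langle 1_K,0\rangle=k$ and $\varphi\circ\langle 0,1_L\rangle=l$. If $A$ is an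 abelian object (that is, $1_A$ Huq-commutes with itself), then $A$ is a zero object. 3. Suppose that $\mathcal{C}$ is pointed and has binary sums. The *Higgins commutator* $[K,L]$ of subobjects $k\colon K\to D$, $l\colon L\to D$ is the image in $D$ of the kernel of the canonical morphism $K+L\to K\times L$ under the morphism $K+L\to D$ induced by $k$ and $l$. The *normalisation* of an equivalence relation $R$ on $X$ is the subobject of $X$ given by the kernel of the first projection $R\to X$ followed by the second projection $R\to X$. Then: - for all normal subobjects (kernels) $K$, $L$ of an object $D$, one has $[K,L]=K\wedge L$; - normalisation preserves binary intersections of equivalence relations; - if $\mathcal{C}$ is, in addition, protomodular (so that it is a semi-abelian category), then it satisfies the *Smith is Huq* condition: two equivalence relations on the same object centralise each other as soon as their normalisations Huq-commute. -/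

import Mathlib

open CategoryTheory CategoryTheory.Limits

universe v u

noncomputable section

namespace SmithHuq

/-! ### Barr exact, Mal'tsev and arithmetical categories -/

/-- A (Barr) exact category: a regular category in which every internal equivalence relation is
effective, i.e. the kernel pair of its quotient. -/
class BarrExact (C : Type u) [Category.{v} C] : Prop extends Regular C where
  effective : ∀ {R X : C} (p₁ p₂ : R ⟶ X), IsEquivalenceRelation p₁ p₂ →
    IsEffectiveEquivalenceRelation p₁ p₂

/-- A Mal'tsev category: a category with finite limits in which every internal reflexive relation
is an equivalence relation. -/
class Maltsev (C : Type u) [Category.{v} C] : Prop extends HasFiniteLimits C where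
  isEquivalenceRelation : ∀ {R X : C} (p₁ p₂ : R ⟶ X), Nonempty (ReflexiveRelation p₁ p₂) →
    IsEquivalenceRelation p₁ p₂

/-- An internal groupoid: objects `G₀`, arrows `G₁`, domain `d`, codomain `c`, identities `e`,
inverses `inv`, and composition `comp` of the pairs `(f, g)` of arrows with `c f = d g`
(in diagrammatic order). The associativity law is stated on generalised elements. -/
structure InternalGroupoid (C : Type u) [Category.{v} C] [HasPullbacks C] where
  G₀ : C
  G₁ : C
  d : G₁ ⟶ G₀
  c : G₁ ⟶ G₀
  e : G₀ ⟶ G₁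
  comp : pullback c d ⟶ G₁
  inv : G₁ ⟶ G₁
  e_d : e ≫ d = 𝟙 G₀
  e_c : e ≫ c = 𝟙 G₀
  comp_d : comp ≫ d = pullback.fst c d ≫ d
  comp_c : comp ≫ c = pullback.snd c d ≫ c
  inv_d : inv ≫ d = c
  inv_c : inv ≫ c = d
  id_comp : pullback.lift (d ≫ e) (𝟙 G₁) (by simp [e_c]) ≫ comp = 𝟙 G₁
  comp_id : pullback.lift (𝟙 G₁) (c ≫ e) (by simp [e_d]) ≫ comp = 𝟙 G₁
  comp_inv : pullback.lift (𝟙 G₁) inv (by simp [inv_d]) ≫ comp = d ≫ e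
  inv_comp : pullback.lift inv (𝟙 G₁) (by simp [inv_c]) ≫ comp = c ≫ e
  assoc : ∀ {T : C} (f g h : T ⟶ G₁) (hfg : f ≫ c = g ≫ d) (hgh : g ≫ c = h ≫ d),
    pullback.lift (pullback.lift f g hfg ≫ comp) h (by rw [Category.assoc, comp_c, ← Category.assoc, pullback.lift_snd, hgh]) ≫ comp =
      pullback.lift f (pullback.lift g h hgh ≫ comp) (by rw [Category.assoc, comp_d, ← Category.assoc, pullback.lift_fst, hfg]) ≫ comp

/-- An arithmetical category: an exact Mal'tsev category in which every internal groupoid is an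
equivalence relation. -/
class Arithmetical (C : Type u) [Category.{v} C] : Prop extends BarrExact C, Maltsev C where
  groupoid : ∀ G : InternalGroupoid C, IsEquivalenceRelation G.d G.c

/-! ### Relations as subobjects of `X ⨯ X` -/

section Relations

variable {C : Type u} [Category.{v} C] [HasFiniteLimits C] {X : C}

/-- First projection of a relation. -/
abbrev relFst (R : Subobject (X ⨯ X)) : (R : C) ⟶ X := R.arrow ≫ prod.fst

/-- Second projection of a relation. -/
abbrev relSnd (R : Subobject (X ⨯ X)) : (R : C) ⟶ X := R.arrow ≫ prod.snd

/-- The subobject `R` of `X ⨯ X` is an internal equivalence relation on `X`. -/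
def IsEquivRel (R : Subobject (X ⨯ X)) : Prop := IsEquivalenceRelation (relFst R) (relSnd R)

/-- `x R y` for generalised elements `x y : T ⟶ X`. -/
abbrev Related (R : Subobject (X ⨯ X)) {T : C} (x y : T ⟶ X) : Prop := R.Factors (prod.lift x y)

/-- The object `R ×_X S` of triples `(x, y, z)` with `x R y` and `y S z`. -/
abbrev Triples (R S : Subobject (X ⨯ X)) : C := pullback (relSnd R) (relFst S)

/-- The generalised element `(x, y, z)` of `R ×_X S`. -/
def triple {R S : Subobject (X ⨯ X)} {T : C} (x y z : T ⟶ X) (hxy : Related R x y)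
    (hyz : Related S y z) : T ⟶ Triples R S :=
  pullback.lift (R.factorThru (prod.lift x y) hxy) (S.factorThru (prod.lift y z) hyz)
    (by simp [prod.lift_fst, prod.lift_snd])

/-- `p : R ×_X S ⟶ X` is a connector between the equivalence relations `R` and `S`. -/
structure IsConnector (R S : Subobject (X ⨯ X)) (p : Triples R S ⟶ X) : Prop where
  related_left : ∀ {T : C} (x y z : T ⟶ X) (hxy : Related R x y) (hyz : Related S y z),
    Related S x (triple x y z hxy hyz ≫ p)
  related_right : ∀ {T : C} (x y z : T ⟶ X) (hxy : Related R x y) (hyz : Related S y z),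
    Related R z (triple x y z hxy hyz ≫ p)
  left_id : ∀ {T : C} (x z : T ⟶ X) (hxx : Related R x x) (hxz : Related S x z),
    triple x x z hxx hxz ≫ p = z
  right_id : ∀ {T : C} (x y : T ⟶ X) (hxy : Related R x y) (hyy : Related S y y),
    triple x y y hxy hyy ≫ p = x
  /-- `p(x, y, p(y, t, w)) = p(x, t, w)` -/
  assoc_left : ∀ {T : C} (x y t w : T ⟶ X) (hxy : Related R x y) (hyt : Related R y t)
    (htw : Related S t w) (hxt : Related R x t) (hy : Related S y (triple y t w hyt htw ≫ p)),
    triple x y (triple y t w hyt htw ≫ p) hxy hy ≫ p = triple x t w hxt htw ≫ p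
  /-- `p(p(x, y, t), t, w) = p(x, y, w)` -/
  assoc_right : ∀ {T : C} (x y t w : T ⟶ X) (hxy : Related R x y) (hyt : Related S y t)
    (htw : Related S t w) (hyw : Related S y w) (ht : Related R (triple x y t hxy hyt ≫ p) t),
    triple (triple x y t hxy hyt ≫ p) t w ht htw ≫ p = triple x y w hxy hyw ≫ p

/-- `R` and `S` centralise each other (commute in the sense of Smith). -/
def Centralise (R S : Subobject (X ⨯ X)) : Prop := ∃ p : Triples R S ⟶ X, IsConnector R S p

end Relations

section Smith

variable {C : Type u} [Category.{v} C] [Regular C] {X : C}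

/-- The image of a relation `R` on `X` along `q : X ⟶ Y`, a relation on `Y`. -/
def directImage {Y : C} (q : X ⟶ Y) (R : Subobject (X ⨯ X)) : Subobject (Y ⨯ Y) :=
  imageSubobject (R.arrow ≫ prod.map q q)

/-- The images of `R` and `S` in the quotient of `X` by `T` centralise each other. -/
def CentraliseModulo (R S T : Subobject (X ⨯ X)) : Prop :=
  ∃ (Y : C) (q : X ⟶ Y), IsRegularEpi q ∧ IsKernelPair q (relFst T) (relSnd T) ∧
    Centralise (directImage q R) (directImage q S)

/-- `T` is the Smith commutator of the equivalence relations `R` and `S` on `X`: the smallest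
equivalence relation on `X` modulo which `R` and `S` centralise each other. -/
def IsSmithCommutator (R S T : Subobject (X ⨯ X)) : Prop :=
  IsLeast {T' : Subobject (X ⨯ X) | IsEquivRel T' ∧ CentraliseModulo R S T'} T

end Smith

/-! ### Pointed notions -/

section Pointed

variable {C : Type u} [Category.{v} C] [HasZeroMorphisms C]

/-- The arrows `k` and `l` commute in the sense of Huq. -/
def HuqCommute [HasBinaryProducts C] {K L D : C} (k : K ⟶ D) (l : L ⟶ D) : Prop :=
  ∃ φ : K ⨯ L ⟶ D, prod.lift (𝟙 K) 0 ≫ φ = k ∧ prod.lift 0 (𝟙 L) ≫ φ = l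

/-- An abelian object (in a pointed Mal'tsev category): one whose identity Huq-commutes with
itself. -/
def IsAbelianObject [HasBinaryProducts C] (A : C) : Prop := HuqCommute (𝟙 A) (𝟙 A)

/-- A normal subobject: the kernel of some arrow. -/
def IsNormalSubobject [HasKernels C] {D : C} (K : Subobject D) : Prop :=
  ∃ (E : C) (f : D ⟶ E), K = kernelSubobject f

/-- The normalisation of a relation `R` on `X`: the inverse image of `R` along
`⟨0, 1⟩ : X ⟶ X ⨯ X`, i.e. the kernel of the first projection of `R`, included in `X` by the
second projection. -/
def normalisation [HasFiniteLimits C] {X : C} (R : Subobject (X ⨯ X)) : Subobject X :=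
  (Subobject.pullback (prod.lift 0 (𝟙 X))).obj R

/-- The Higgins commutator `[K, L]` of two subobjects of `D`: the image of the composite
`K ⋄ L ⟶ K ⨿ L ⟶ D`, where `K ⋄ L` is the kernel of the comparison `K ⨿ L ⟶ K ⨯ L`. -/
def higginsCommutator [Regular C] [HasBinaryCoproducts C] {D : C} (K L : Subobject D) :
    Subobject D :=
  imageSubobject
    (kernel.ι (coprod.desc (prod.lift (𝟙 (K : C)) (0 : (K : C) ⟶ (L : C)))
      (prod.lift (0 : (L : C) ⟶ (K : C)) (𝟙 (L : C)))) ≫ coprod.desc K.arrow L.arrow)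

/-- The *Smith is Huq* condition: equivalence relations centralise each other as soon as their
normalisations Huq-commute. -/
def SmithIsHuq (C : Type u) [Category.{v} C] [HasZeroMorphisms C] [HasFiniteLimits C] : Prop :=
  ∀ {X : C} (R S : Subobject (X ⨯ X)), IsEquivRel R → IsEquivRel S →
    HuqCommute (normalisation R).arrow (normalisation S).arrow → Centralise R S

end Pointed

/-- Protomodularity: the change-of-base functors `p^* : Pt_B ⥤ Pt_E` between the categories of
points (split epimorphisms with chosen section) reflect isomorphisms. -/
def Protomodular (C : Type u) [Category.{v} C] [HasPullbacks C] : Prop :=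
  ∀ {E B A A' : C} (p : E ⟶ B) (f : A ⟶ B) (s : B ⟶ A) (f' : A' ⟶ B) (s' : B ⟶ A')
    (_ : s ≫ f = 𝟙 B) (_ : s' ≫ f' = 𝟙 B) (h : A ⟶ A') (hf : h ≫ f' = f) (_ : s ≫ h = s'),
    IsIso (pullback.map p f p f' (𝟙 E) h (𝟙 B) (by simp) (by simp [hf])) → IsIso h

end SmithHuq

end

/-!
In a Mal'tsev category a composition on a reflexive graph that merely satisfies the unit laws is
associative and has inverses, so in an arithmetical category any such graph is a relation. A
connector `p` between `R` and `S` composes the pairs in `R ⊓ S` with common first component, through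
`(x, y) (x, z) = (x, p(y, x, z))`; hence `R ⊓ S` is discrete. Conversely, if `R ⊓ S` is discrete,
then a triple `(x, y, z)` is determined by `(x, z)`, and the symmetry of this reflexive relation
yields a connector. Passing to quotients gives the Smith commutator.

An abelian object is a multiplicative graph over the terminal object, hence zero. Applied to
`X / [X, X]` this gives `[X, X] = X`, so that `[K, L]` contains `[K ⊓ L, K ⊓ L] = K ⊓ L`. Applied to
the intersection of two Huq-commuting subobjects it gives Smith is Huq, because in a protomodular
category a relation with zero normalisation is discrete.
-/

namespace SmithHuq

attribute [local simp] prod.lift_fst prod.lift_snd pullback.lift_fst pullback.lift_snd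
  prod.lift_fst_assoc prod.lift_snd_assoc pullback.lift_fst_assoc pullback.lift_snd_assoc

section Relations

variable {C : Type u} [Category.{v} C]

theorem factors_of_strongEpi_comp {S T X : C} {M : Subobject X} {e : S ⟶ T} [StrongEpi e]
    {f : T ⟶ X} (h : M.Factors (e ≫ f)) : M.Factors f := by
  have sq : CommSq (M.factorThru _ h) e M.arrow f := ⟨by simp⟩
  rw [← sq.fac_right]
  exact Subobject.factors_comp_arrow _

theorem factors_lift_comp [HasBinaryProducts C] {X Y S T : C} {M : Subobject (X ⨯ Y)} {x : T ⟶ X}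
    {y : T ⟶ Y} (h : M.Factors (prod.lift x y)) (u : S ⟶ T) :
    M.Factors (prod.lift (u ≫ x) (u ≫ y)) := by
  rw [← prod.comp_lift]
  exact Subobject.factors_of_factors_right _ h

theorem factors_lift_arrow [HasBinaryProducts C] {X Y T : C} (M : Subobject (X ⨯ Y)) (f : T ⟶ M) :
    M.Factors (prod.lift (f ≫ M.arrow ≫ prod.fst) (f ≫ M.arrow ≫ prod.snd)) := by
  have : prod.lift (f ≫ M.arrow ≫ prod.fst) (f ≫ M.arrow ≫ prod.snd) = f ≫ M.arrow := by
    ext <;> simp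
  rw [this]
  exact Subobject.factors_comp_arrow _

instance jointlyMono₂_arrow [HasBinaryProducts C] {X Y : C} (M : Subobject (X ⨯ Y)) :
    JointlyMono₂ (M.arrow ≫ prod.fst) (M.arrow ≫ prod.snd) where
  right_cancellation _ f g h₁ h₂ := by
    rw [← cancel_mono M.arrow]
    ext <;> simpa

theorem mono_lift_of_jointlyMono₂ [HasBinaryProducts C] {A B R : C} (p : R ⟶ A) (q : R ⟶ B)
    [JointlyMono₂ p q] : Mono (prod.lift p q) where
  right_cancellation f g h := JointlyMono₂.right_cancellation (p₁ := p) (p₂ := q) f g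
    (by simpa using h =≫ prod.fst) (by simpa using h =≫ prod.snd)

variable [HasFiniteLimits C] {X : C} {R S : Subobject (X ⨯ X)}

namespace IsEquivRel

theorem refl (hR : IsEquivRel R) {T : C} (x : T ⟶ X) : Related R x x := by
  obtain ⟨⟨E⟩⟩ := hR
  simpa using factors_lift_arrow R (x ≫ E.r)

theorem symm (hR : IsEquivRel R) {T : C} {x y : T ⟶ X} (h : Related R x y) : Related R y x := by
  obtain ⟨⟨E⟩⟩ := hR
  simpa [E.symmetry₁, E.symmetry₂] using factors_lift_arrow R (R.factorThru _ h ≫ E.s)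

theorem trans (hR : IsEquivRel R) {T : C} {x y z : T ⟶ X} (h : Related R x y)
    (h' : Related R y z) : Related R x z := by
  obtain ⟨⟨E⟩⟩ := hR
  obtain ⟨l, hl₁, hl₂⟩ := PullbackCone.IsLimit.lift' E.isLimit (R.factorThru _ h)
    (R.factorThru _ h') (by simp)
  simpa [E.transitivity₁, E.transitivity₂, reassoc_of% hl₁, reassoc_of% hl₂] using
    factors_lift_arrow R (l ≫ E.t)

end IsEquivRel

theorem related_inf_iff {T : C} {x y : T ⟶ X} :
    Related (R ⊓ S) x y ↔ Related R x y ∧ Related S x y :=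
  Subobject.inf_factors _

theorem le_of_related (h : ∀ ⦃T : C⦄ (x y : T ⟶ X), Related R x y → Related S x y) : R ≤ S := by
  apply Subobject.le_of_factors
  have hS := h _ _ (factors_lift_arrow R (𝟙 _))
  rwa [Related, Category.id_comp, Category.id_comp, ← prod.comp_lift, prod.lift_fst_snd,
    Category.comp_id] at hS

/-- A relation contained in the diagonal; for an equivalence relation this says that it is the
discrete one. -/
def IsDiscrete (R : Subobject (X ⨯ X)) : Prop :=
  ∀ ⦃T : C⦄ ⦃x y : T ⟶ X⦄, Related R x y → x = y

theorem isDiscrete_iff_relFst_eq_relSnd : IsDiscrete R ↔ relFst R = relSnd R := by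
  constructor
  · intro h
    exact h (by simpa using factors_lift_arrow R (𝟙 (R : C)))
  · intro h T x y hxy
    simpa using R.factorThru _ hxy ≫= h

namespace Triples

/-- The coordinate `x` of the triples `(x, y, z)` of `R ×_X S`. -/
noncomputable def left (R S : Subobject (X ⨯ X)) : Triples R S ⟶ X :=
  pullback.fst _ _ ≫ relFst R

/-- The coordinate `y` of the triples `(x, y, z)` of `R ×_X S`. -/
noncomputable def mid (R S : Subobject (X ⨯ X)) : Triples R S ⟶ X :=
  pullback.fst _ _ ≫ relSnd R

/-- The coordinate `z` of the triples `(x, y, z)` of `R ×_X S`. -/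
noncomputable def right (R S : Subobject (X ⨯ X)) : Triples R S ⟶ X :=
  pullback.snd _ _ ≫ relSnd S

theorem related_left_mid : Related R (left R S) (mid R S) :=
  factors_lift_arrow R _

theorem related_mid_right : Related S (mid R S) (right R S) := by
  rw [mid, pullback.condition]
  exact factors_lift_arrow S _

theorem hom_ext {T : C} {f g : T ⟶ Triples R S} (h₁ : f ≫ left R S = g ≫ left R S)
    (h₂ : f ≫ mid R S = g ≫ mid R S) (h₃ : f ≫ right R S = g ≫ right R S) : f = g := by
  apply pullback.hom_ext
  · apply JointlyMono₂.right_cancellation (p₁ := relFst R) (p₂ := relSnd R)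
    · simpa [left] using h₁
    · simpa [mid] using h₂
  · apply JointlyMono₂.right_cancellation (p₁ := relFst S) (p₂ := relSnd S)
    · simpa [mid, pullback.condition] using h₂
    · simpa [right] using h₃

end Triples

section Triple

variable {T : C} (x y z : T ⟶ X) (hxy : Related R x y) (hyz : Related S y z)

@[simp]
theorem triple_left : triple x y z hxy hyz ≫ Triples.left R S = x := by
  simp [triple, Triples.left]

@[simp]
theorem triple_mid : triple x y z hxy hyz ≫ Triples.mid R S = y := by
  simp [triple, Triples.mid]

@[simp]
theorem triple_right : triple x y z hxy hyz ≫ Triples.right R S = z := by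
  simp [triple, Triples.right]

theorem comp_triple {U : C} (u : U ⟶ T) : u ≫ triple x y z hxy hyz =
    triple (u ≫ x) (u ≫ y) (u ≫ z) (factors_lift_comp hxy u) (factors_lift_comp hyz u) := by
  apply Triples.hom_ext <;> simp

end Triple

end Relations

section Maltsev

variable {C : Type u} [Category.{v} C] [Maltsev C]

theorem isEquivRel_of_related_id {X : C} {R : Subobject (X ⨯ X)} (h : Related R (𝟙 X) (𝟙 X)) :
    IsEquivRel R :=
  Maltsev.isEquivalenceRelation _ _
    ⟨{ toJointlyMono₂ := jointlyMono₂_arrow R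
       r := R.factorThru _ h
       reflexivity₁ := by simp
       reflexivity₂ := by simp }⟩

theorem IsEquivRel.inf {X : C} {R S : Subobject (X ⨯ X)} (hR : IsEquivRel R) (hS : IsEquivRel S) :
    IsEquivRel (R ⊓ S) :=
  isEquivRel_of_related_id (related_inf_iff.2 ⟨hR.refl _, hS.refl _⟩)

theorem difunctional {A B T : C} {M : Subobject (A ⨯ B)} {a c : T ⟶ A} {b d : T ⟶ B}
    (hab : M.Factors (prod.lift a b)) (hcb : M.Factors (prod.lift c b))
    (hcd : M.Factors (prod.lift c d)) : M.Factors (prod.lift a d) := by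
  -- The relation `(a, b) E (c, d) ↔ a M d` on `M` is reflexive, hence symmetric.
  let E : Subobject ((M : C) ⨯ (M : C)) :=
    (Subobject.pullback (prod.map (M.arrow ≫ prod.fst) (M.arrow ≫ prod.snd))).obj M
  have related_iff : ∀ {S : C} (m n : S ⟶ M), Related E m n ↔
      M.Factors (prod.lift (m ≫ M.arrow ≫ prod.fst) (n ≫ M.arrow ≫ prod.snd)) := fun m n => by
    rw [Related, pullback_factors_iff, prod.lift_map]
  have hE : IsEquivRel E :=
    isEquivRel_of_related_id ((related_iff _ _).2 (factors_lift_arrow M (𝟙 _)))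
  have hcb' : Related E (M.factorThru _ hcd) (M.factorThru _ hab) :=
    (related_iff _ _).2 (by simpa)
  simpa using (related_iff _ _).1 (hE.symm hcb')

theorem difunctional_of_jointlyMono₂ {A B R T : C} (p : R ⟶ A) (q : R ⟶ B) [JointlyMono₂ p q]
    (r₁ r₂ r₃ : T ⟶ R) (h₁₂ : r₁ ≫ q = r₂ ≫ q) (h₂₃ : r₂ ≫ p = r₃ ≫ p) :
    ∃ r : T ⟶ R, r ≫ p = r₁ ≫ p ∧ r ≫ q = r₃ ≫ q := by
  have := mono_lift_of_jointlyMono₂ p q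
  have factors (r : T ⟶ R) :
      (Subobject.mk (prod.lift p q)).Factors (prod.lift (r ≫ p) (r ≫ q)) :=
    (Subobject.mk_factors_iff _ _).2 ⟨r, prod.comp_lift r p q⟩
  obtain ⟨r, hr⟩ : ∃ r, r ≫ prod.lift p q = prod.lift (r₁ ≫ p) (r₃ ≫ q) :=
    (Subobject.mk_factors_iff (prod.lift p q) _).1
      (difunctional (h₁₂ ▸ factors r₁) (factors r₂) (h₂₃ ▸ factors r₃))
  exact ⟨r, by simpa using hr =≫ prod.fst, by simpa using hr =≫ prod.snd⟩

section Sections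

variable {P A B D : C} {p₁ : P ⟶ A} {p₂ : P ⟶ B} {f : A ⟶ D} {g : B ⟶ D} {s : D ⟶ A} {t : D ⟶ B}

theorem eq_top_of_factors_sections (hP : IsPullback p₁ p₂ f g) (hs : s ≫ f = 𝟙 D)
    (ht : t ≫ g = 𝟙 D) {M : Subobject P}
    (hA : M.Factors (hP.lift (𝟙 A) (f ≫ t) (by simp [ht])))
    (hB : M.Factors (hP.lift (g ≫ s) (𝟙 B) (by simp [hs]))) : M = ⊤ := by
  have : JointlyMono₂ (M.arrow ≫ p₁) (M.arrow ≫ p₂) :=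
    ⟨fun _ _ _ h₁ h₂ =>
      (cancel_mono M.arrow).1 (hP.hom_ext (by simpa using h₁) (by simpa using h₂))⟩
  -- `(a, t f a)`, `(s f a, t f a)` and `(s g b, b)` lie in `M`, hence so does `(a, b)`.
  obtain ⟨r, hr₁, hr₂⟩ := difunctional_of_jointlyMono₂ (M.arrow ≫ p₁) (M.arrow ≫ p₂)
    (p₁ ≫ M.factorThru _ hA) (p₁ ≫ f ≫ s ≫ M.factorThru _ hA) (p₂ ≫ M.factorThru _ hB)
    (by simp [reassoc_of% hs]) (by simp [reassoc_of% hP.w])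
  have hr : r ≫ M.arrow = 𝟙 P := hP.hom_ext (by simpa using hr₁) (by simpa using hr₂)
  exact top_le_iff.1 (Subobject.le_of_comm (Subobject.arrow ⊤ ≫ r) (by simp [hr]))

theorem hom_ext_of_sections (hP : IsPullback p₁ p₂ f g) (hs : s ≫ f = 𝟙 D) (ht : t ≫ g = 𝟙 D)
    {Z : C} {u v : P ⟶ Z}
    (hA : hP.lift (𝟙 A) (f ≫ t) (by simp [ht]) ≫ u = hP.lift (𝟙 A) (f ≫ t) (by simp [ht]) ≫ v)
    (hB : hP.lift (g ≫ s) (𝟙 B) (by simp [hs]) ≫ u = hP.lift (g ≫ s) (𝟙 B) (by simp [hs]) ≫ v) :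
    u = v := by
  have h : equalizerSubobject u v = ⊤ := eq_top_of_factors_sections hP hs ht
    ((equalizerSubobject_factors_iff _ _ _).2 hA) ((equalizerSubobject_factors_iff _ _ _).2 hB)
  simpa using (equalizerSubobject_factors_iff u v (𝟙 P)).1 (h ▸ Subobject.top_factors _)

end Sections

end Maltsev

section MultiplicativeGraphs

/-- A reflexive graph `d, c : G₁ ⟶ G₀` with identities `e` and a composition `comp` of composable
arrows (in diagrammatic order) satisfying the unit laws, but no associativity. In a Mal'tsev
category this is all that it takes to be an internal groupoid. -/
structure MultiplicativeGraph (C : Type u) [Category.{v} C] [HasPullbacks C] where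
  G₀ : C
  G₁ : C
  d : G₁ ⟶ G₀
  c : G₁ ⟶ G₀
  e : G₀ ⟶ G₁
  comp : pullback c d ⟶ G₁
  e_d : e ≫ d = 𝟙 G₀
  e_c : e ≫ c = 𝟙 G₀
  comp_d : comp ≫ d = pullback.fst c d ≫ d
  comp_c : comp ≫ c = pullback.snd c d ≫ c
  id_comp : pullback.lift (d ≫ e) (𝟙 G₁) (by simp [e_c]) ≫ comp = 𝟙 G₁
  comp_id : pullback.lift (𝟙 G₁) (c ≫ e) (by simp [e_d]) ≫ comp = 𝟙 G₁

namespace MultiplicativeGraph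

section HasPullbacks

variable {C : Type u} [Category.{v} C] [HasPullbacks C] (G : MultiplicativeGraph C) {S T : C}

/-- The composite of two composable generalised arrows of a multiplicative graph. -/
noncomputable def mul (f g : T ⟶ G.G₁) (h : f ≫ G.c = g ≫ G.d) : T ⟶ G.G₁ :=
  pullback.lift f g h ≫ G.comp

@[simp]
theorem mul_d (f g : T ⟶ G.G₁) (h : f ≫ G.c = g ≫ G.d) : G.mul f g h ≫ G.d = f ≫ G.d := by
  simp [mul, G.comp_d]

@[simp]
theorem mul_c (f g : T ⟶ G.G₁) (h : f ≫ G.c = g ≫ G.d) : G.mul f g h ≫ G.c = g ≫ G.c := by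
  simp [mul, G.comp_c]

theorem comp_mul (u : S ⟶ T) (f g : T ⟶ G.G₁) (h : f ≫ G.c = g ≫ G.d) :
    u ≫ G.mul f g h = G.mul (u ≫ f) (u ≫ g) (by simp [h]) := by
  rw [mul, mul, ← Category.assoc]
  congr 1
  apply pullback.hom_ext <;> simp

@[simp]
theorem id_mul (a : T ⟶ G.G₀) (f : T ⟶ G.G₁) (h : (a ≫ G.e) ≫ G.c = f ≫ G.d) :
    G.mul (a ≫ G.e) f h = f := by
  obtain rfl : a = f ≫ G.d := by simpa [G.e_c] using h
  have h₁ : G.mul (G.d ≫ G.e) (𝟙 _) (by simp [G.e_c]) = 𝟙 _ := G.id_comp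
  simpa [comp_mul] using f ≫= h₁

@[simp]
theorem mul_id (a : T ⟶ G.G₀) (f : T ⟶ G.G₁) (h : f ≫ G.c = (a ≫ G.e) ≫ G.d) :
    G.mul f (a ≫ G.e) h = f := by
  obtain rfl : a = f ≫ G.c := by simpa [G.e_d] using h.symm
  have h₁ : G.mul (𝟙 _) (G.c ≫ G.e) (by simp [G.e_d]) = 𝟙 _ := G.comp_id
  simpa [comp_mul] using f ≫= h₁

end HasPullbacks

section Maltsev

variable {C : Type u} [Category.{v} C] [Maltsev C] (G : MultiplicativeGraph C) {T : C}

theorem mul_assoc (f g k : T ⟶ G.G₁) (hfg : f ≫ G.c = g ≫ G.d) (hgk : g ≫ G.c = k ≫ G.d) :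
    G.mul (G.mul f g hfg) k (by simp [hgk]) = G.mul f (G.mul g k hgk) (by simp [hfg]) := by
  -- On composable triples the two sides agree at `(f, 1, 1)` and at `(1, g, k)`.
  have hP := IsPullback.of_hasPullback G.c (pullback.fst G.c G.d ≫ G.d)
  have ht : pullback.lift G.e G.e (by simp [G.e_c, G.e_d]) ≫ pullback.fst G.c G.d ≫ G.d = 𝟙 _ := by
    simp [G.e_d]
  have h₁ := hP.w
  have h₂ := pullback.condition (f := G.c) (g := G.d)
  have universal : G.mul (G.mul (pullback.fst _ _) (pullback.snd G.c (pullback.fst G.c G.d ≫ G.d) ≫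
      pullback.fst _ _) (by simpa using h₁)) (pullback.snd _ _ ≫ pullback.snd _ _) (by simp [h₂]) =
      G.mul (pullback.fst _ _) (G.mul (pullback.snd _ _ ≫ pullback.fst _ _)
        (pullback.snd _ _ ≫ pullback.snd _ _) (by simp [h₂])) (by simpa using h₁) := by
    refine hom_ext_of_sections hP G.e_c ht ?_ ?_
    · simp [comp_mul]
    · simp only [comp_mul, hP.lift_fst, hP.lift_snd_assoc, Category.id_comp, id_mul]
  have := hP.lift f (pullback.lift g k hgk) (by simpa using hfg) ≫= universal
  simp only [comp_mul, hP.lift_fst, hP.lift_snd_assoc, pullback.lift_fst, pullback.lift_snd] at this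
  exact this

theorem mul_left_cancel {f g k : T ⟶ G.G₁} (hg : f ≫ G.c = g ≫ G.d) (hk : f ≫ G.c = k ≫ G.d)
    (h : G.mul f g hg = G.mul f k hk) : g = k := by
  -- Difunctionality of the relation `f g = f k` between arrows `f` and pairs `(g, k)`, applied to
  -- `(1, (1, 1))`, `(f, (1, 1))` and `(f, (g, k))`.
  let m := prod.lift (pullback.fst G.c G.d) G.comp
  let p : pullback m m ⟶ G.G₁ := pullback.fst m m ≫ pullback.fst _ _
  let q : pullback m m ⟶ G.G₁ ⨯ G.G₁ :=
    prod.lift (pullback.fst m m ≫ pullback.snd _ _) (pullback.snd m m ≫ pullback.snd _ _)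
  have hp : p = pullback.snd m m ≫ pullback.fst _ _ := by
    simpa [m, p] using pullback.condition (f := m) (g := m) =≫ prod.fst
  have : JointlyMono₂ p q := ⟨fun _ u v h₁ h₂ => by
    have h₃ := h₂ =≫ prod.fst
    have h₄ := h₂ =≫ prod.snd
    apply pullback.hom_ext <;> apply pullback.hom_ext
    · simpa [p] using h₁
    · simpa [q] using h₃
    · simpa [hp] using h₁
    · simpa [q] using h₄⟩
  let pair (f g k : T ⟶ G.G₁) (hg : f ≫ G.c = g ≫ G.d) (hk : f ≫ G.c = k ≫ G.d)
      (h : G.mul f g hg = G.mul f k hk) : T ⟶ pullback m m :=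
    pullback.lift (pullback.lift f g hg) (pullback.lift f k hk) (by
      ext
      · simp [m]
      · simpa [m, mul] using h)
  let o := (f ≫ G.c) ≫ G.e
  have ho : o ≫ G.c = o ≫ G.d := by simp [o, G.e_c, G.e_d]
  have hfo : f ≫ G.c = o ≫ G.d := by simp [o, G.e_d]
  obtain ⟨r, hr₁, hr₂⟩ := difunctional_of_jointlyMono₂ p q (pair o o o ho ho rfl)
    (pair f o o hfo hfo rfl) (pair f g k hg hk h) (by ext <;> simp [q, pair]) (by simp [p, pair])
  have hr₃ := hr₂ =≫ prod.fst
  have hr₄ := hr₂ =≫ prod.snd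
  have hg' : r ≫ pullback.fst m m = pullback.lift o g (by simp [o, G.e_c, ← hg]) := by
    apply pullback.hom_ext
    · simpa [p, pair] using hr₁
    · simpa [q, pair] using hr₃
  have hk' : r ≫ pullback.snd m m = pullback.lift o k (by simp [o, G.e_c, ← hk]) := by
    apply pullback.hom_ext
    · simpa [hp, pair] using hr₁
    · simpa [q, pair] using hr₄
  have hgk : r ≫ pullback.fst m m ≫ G.comp = r ≫ pullback.snd m m ≫ G.comp := by
    simpa [m] using (r ≫= pullback.condition (f := m) (g := m)) =≫ prod.snd
  rwa [reassoc_of% hg', reassoc_of% hk', ← mul, ← mul, id_mul, id_mul] at hgk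

theorem exists_right_inverse : ∃ (i : G.G₁ ⟶ G.G₁) (h : 𝟙 G.G₁ ≫ G.c = i ≫ G.d),
    G.mul (𝟙 G.G₁) i h = G.d ≫ G.e := by
  -- Difunctionality of the relation `∃ g, f g = h` between `f` and `h`, where `g` is unique by
  -- cancellation, applied to `(f, f)`, `(1, f)` and `(1, 1)`.
  have : JointlyMono₂ (pullback.fst G.c G.d) G.comp := ⟨fun _ u v h₁ h₂ => by
    refine pullback.hom_ext h₁ (G.mul_left_cancel (f := u ≫ pullback.fst _ _) ?_ ?_ ?_)
    · simp [pullback.condition]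
    · simp [h₁, pullback.condition]
    · have hu : pullback.lift (u ≫ pullback.fst _ _) (u ≫ pullback.snd _ _)
          (by simp [pullback.condition]) = u := by apply pullback.hom_ext <;> simp
      have hv : pullback.lift (u ≫ pullback.fst _ _) (v ≫ pullback.snd _ _)
          (by simp [h₁, pullback.condition]) = v := by apply pullback.hom_ext <;> simp [h₁]
      rwa [mul, mul, hu, hv]⟩
  obtain ⟨r, hr₁, hr₂⟩ := difunctional_of_jointlyMono₂ (pullback.fst G.c G.d) G.comp
    (pullback.lift (𝟙 _) (G.c ≫ G.e) (by simp [G.e_d]))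
    (pullback.lift (G.d ≫ G.e) (𝟙 _) (by simp [G.e_c]))
    (pullback.lift (G.d ≫ G.e) (G.d ≫ G.e) (by simp [G.e_c, G.e_d]))
    (G.comp_id.trans G.id_comp.symm) (by simp)
  have hr₃ : r ≫ pullback.fst G.c G.d = 𝟙 _ := by simpa using hr₁
  have h : 𝟙 G.G₁ ≫ G.c = (r ≫ pullback.snd G.c G.d) ≫ G.d := by
    rw [← hr₃, Category.assoc, Category.assoc, pullback.condition]
  have hr : pullback.lift (𝟙 _) (r ≫ pullback.snd G.c G.d) h = r := by
    apply pullback.hom_ext <;> simp [hr₃]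
  exact ⟨r ≫ pullback.snd G.c G.d, h, by rw [mul, hr, hr₂, ← mul, id_mul]⟩

theorem exists_inverse : ∃ (i : G.G₁ ⟶ G.G₁) (hd : i ≫ G.d = G.c) (hc : i ≫ G.c = G.d),
    G.mul (𝟙 G.G₁) i (by simp [hd]) = G.d ≫ G.e ∧ G.mul i (𝟙 G.G₁) (by simp [hc]) = G.c ≫ G.e := by
  obtain ⟨i, h, hi⟩ := G.exists_right_inverse
  have hd : i ≫ G.d = G.c := by simpa using h.symm
  have hc : i ≫ G.c = G.d := by simpa [G.e_c] using hi =≫ G.c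
  refine ⟨i, hd, hc, hi, G.mul_left_cancel (f := 𝟙 _) (by simp [hd]) (by simp [G.e_d]) ?_⟩
  rw [← G.mul_assoc _ _ _ (by simp [hd]) (by simp [hc])]
  simp only [hi, id_mul, mul_id]

/-- A multiplicative graph in a Mal'tsev category is an internal groupoid. -/
noncomputable def toInternalGroupoid : InternalGroupoid C where
  G₀ := G.G₀
  G₁ := G.G₁
  d := G.d
  c := G.c
  e := G.e
  comp := G.comp
  inv := G.exists_inverse.choose
  e_d := G.e_d
  e_c := G.e_c
  comp_d := G.comp_d
  comp_c := G.comp_c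
  inv_d := G.exists_inverse.choose_spec.choose
  inv_c := G.exists_inverse.choose_spec.choose_spec.choose
  id_comp := G.id_comp
  comp_id := G.comp_id
  comp_inv := G.exists_inverse.choose_spec.choose_spec.choose_spec.1
  inv_comp := G.exists_inverse.choose_spec.choose_spec.choose_spec.2
  assoc f g h hfg hgh := G.mul_assoc f g h hfg hgh

theorem jointlyMono₂ (hC : ∀ G : InternalGroupoid C, IsEquivalenceRelation G.d G.c) :
    JointlyMono₂ G.d G.c := by
  obtain ⟨⟨E⟩⟩ := hC G.toInternalGroupoid
  exact E.toJointlyMono₂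

end Maltsev

end MultiplicativeGraph

end MultiplicativeGraphs

section Connectors

variable {C : Type u} [Category.{v} C]

section HasFiniteLimits

variable [HasFiniteLimits C] {X : C} {R S : Subobject (X ⨯ X)}

theorem isConnector_of_isDiscrete_inf (hR : IsEquivRel R) (hS : IsEquivRel S)
    (h : IsDiscrete (R ⊓ S)) {p : Triples R S ⟶ X} (hleft : Related S (Triples.left R S) p)
    (hright : Related R (Triples.right R S) p) : IsConnector R S p := by
  have hl : ∀ {T : C} (x y z : T ⟶ X) (hxy : Related R x y) (hyz : Related S y z),
      Related S x (triple x y z hxy hyz ≫ p) := fun x y z hxy hyz => by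
    simpa using factors_lift_comp hleft (triple x y z hxy hyz)
  have hr : ∀ {T : C} (x y z : T ⟶ X) (hxy : Related R x y) (hyz : Related S y z),
      Related R z (triple x y z hxy hyz ≫ p) := fun x y z hxy hyz => by
    simpa using factors_lift_comp hright (triple x y z hxy hyz)
  have eq_of_related : ∀ {T : C} {x y : T ⟶ X}, Related R x y → Related S x y → x = y :=
    fun hR hS => h (related_inf_iff.2 ⟨hR, hS⟩)
  refine ⟨hl, hr, fun x z hxx hxz => ?_, fun x y hxy hyy => ?_,
    fun x y t w hxy hyt htw hxt hy => ?_, fun x y t w hxy hyt htw hyw ht => ?_⟩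
  · exact (eq_of_related (hr _ _ _ hxx hxz) (hS.trans (hS.symm hxz) (hl _ _ _ hxx hxz))).symm
  · exact (eq_of_related (hR.trans hxy (hr _ _ _ hxy hyy)) (hl _ _ _ hxy hyy)).symm
  · exact eq_of_related
      (hR.trans (hR.symm (hr _ _ _ hxy hy))
        (hR.trans (hR.symm (hr _ _ _ hyt htw)) (hr _ _ _ hxt htw)))
      (hS.trans (hS.symm (hl _ _ _ hxy hy)) (hl _ _ _ hxt htw))
  · exact eq_of_related
      (hR.trans (hR.symm (hr _ _ _ ht htw)) (hr _ _ _ hxy hyw))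
      (hS.trans (hS.symm (hl _ _ _ ht htw))
        (hS.trans (hS.symm (hl _ _ _ hxy hyt)) (hl _ _ _ hxy hyw)))

theorem jointlyMono₂_left_right (hR : IsEquivRel R) (hS : IsEquivRel S) (h : IsDiscrete (R ⊓ S)) :
    JointlyMono₂ (Triples.left R S) (Triples.right R S) where
  right_cancellation T f g hleft hright := by
    refine Triples.hom_ext hleft (h (related_inf_iff.2 ⟨?_, ?_⟩)) hright
    · exact hR.trans (hR.symm (factors_lift_comp Triples.related_left_mid f))
        (hleft ▸ factors_lift_comp Triples.related_left_mid g)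
    · exact hS.trans (factors_lift_comp Triples.related_mid_right f)
        (hright ▸ hS.symm (factors_lift_comp Triples.related_mid_right g))

theorem IsConnector.related_inf (hR : IsEquivRel R) (hS : IsEquivRel S) {p : Triples R S ⟶ X}
    (hp : IsConnector R S p) {T : C} {x y z : T ⟶ X} (hyx : Related R y x) (hyx' : Related S y x)
    (hxz : Related R x z) (hxz' : Related S x z) :
    Related (R ⊓ S) x (triple y x z hyx hxz' ≫ p) :=
  related_inf_iff.2 ⟨hR.trans hxz (hp.related_right _ _ _ _ _),
    hS.trans (hS.symm hyx') (hp.related_left _ _ _ _ _)⟩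

/-- A connector `p` between `R` and `S` makes `R ⊓ S` a multiplicative graph over `X`, with both
`d` and `c` the first projection, through `(x, y) (x, z) = (x, p(y, x, z))`. -/
noncomputable def IsConnector.multiplicativeGraph (hR : IsEquivRel R) (hS : IsEquivRel S)
    {p : Triples R S ⟶ X} (hp : IsConnector R S p) : MultiplicativeGraph C :=
  have hd : pullback.fst _ _ ≫ relFst (R ⊓ S) = pullback.snd _ _ ≫ relFst (R ⊓ S) :=
    pullback.condition
  have hy := related_inf_iff.1
    (factors_lift_arrow (R ⊓ S) (pullback.fst (relFst (R ⊓ S)) (relFst (R ⊓ S))))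
  have hz : Related (R ⊓ S) (pullback.fst _ _ ≫ relFst (R ⊓ S))
      (pullback.snd (relFst (R ⊓ S)) (relFst (R ⊓ S)) ≫ relSnd (R ⊓ S)) :=
    hd ▸ factors_lift_arrow (R ⊓ S) _
  { G₀ := X
    G₁ := (R ⊓ S : Subobject (X ⨯ X))
    d := relFst (R ⊓ S)
    c := relFst (R ⊓ S)
    e := (R ⊓ S).factorThru (prod.lift (𝟙 X) (𝟙 X)) (related_inf_iff.2 ⟨hR.refl _, hS.refl _⟩)
    comp := (R ⊓ S).factorThru _ (hp.related_inf hR hS (hR.symm hy.1) (hS.symm hy.2)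
      (related_inf_iff.1 hz).1 (related_inf_iff.1 hz).2)
    e_d := by simp
    e_c := by simp
    comp_d := by simp
    comp_c := by simpa using hd
    id_comp := by
      apply JointlyMono₂.right_cancellation (p₁ := relFst (R ⊓ S)) (p₂ := relSnd (R ⊓ S)) <;>
        simp [reassoc_of% @comp_triple, hp.left_id]
    comp_id := by
      apply JointlyMono₂.right_cancellation (p₁ := relFst (R ⊓ S)) (p₂ := relSnd (R ⊓ S)) <;>
        simp [reassoc_of% @comp_triple, hp.right_id] }

end HasFiniteLimits

section Maltsev

variable [Maltsev C] {X : C} {R S : Subobject (X ⨯ X)}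

theorem centralise_of_isDiscrete_inf (hR : IsEquivRel R) (hS : IsEquivRel S)
    (h : IsDiscrete (R ⊓ S)) : Centralise R S := by
  -- The jointly monic pair `(x, z)` on triples is a reflexive relation. Its symmetry turns
  -- `(x, y, z)` into a triple `(z, w, x)`, whose middle coordinate is the connector.
  obtain ⟨⟨E⟩⟩ := Maltsev.isEquivalenceRelation (Triples.left R S) (Triples.right R S)
    ⟨{ toJointlyMono₂ := jointlyMono₂_left_right hR hS h
       r := triple (𝟙 X) (𝟙 X) (𝟙 X) (hR.refl _) (hS.refl _)
       reflexivity₁ := by simp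
       reflexivity₂ := by simp }⟩
  refine ⟨E.s ≫ Triples.mid R S, isConnector_of_isDiscrete_inf hR hS h ?_ ?_⟩
  · simpa only [E.symmetry₂] using hS.symm (factors_lift_comp Triples.related_mid_right E.s)
  · simpa only [E.symmetry₁] using factors_lift_comp Triples.related_left_mid E.s

theorem Centralise.isDiscrete_inf (hC : ∀ G : InternalGroupoid C, IsEquivalenceRelation G.d G.c)
    (hR : IsEquivRel R) (hS : IsEquivRel S) (h : Centralise R S) : IsDiscrete (R ⊓ S) := by
  obtain ⟨p, hp⟩ := h
  have : JointlyMono₂ (relFst (R ⊓ S)) (relFst (R ⊓ S)) :=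
    (hp.multiplicativeGraph hR hS).jointlyMono₂ hC
  let δ : X ⟶ (R ⊓ S : Subobject (X ⨯ X)) :=
    (R ⊓ S).factorThru (prod.lift (𝟙 X) (𝟙 X)) (related_inf_iff.2 ⟨hR.refl _, hS.refl _⟩)
  have hδ : relFst (R ⊓ S) ≫ δ = 𝟙 _ :=
    JointlyMono₂.right_cancellation (p₁ := relFst (R ⊓ S)) (p₂ := relFst (R ⊓ S)) _ _
      (by simp [δ]) (by simp [δ])
  rw [isDiscrete_iff_relFst_eq_relSnd]
  simpa [δ] using hδ =≫ relSnd (R ⊓ S)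

end Maltsev

end Connectors

section Regular

variable {C : Type u} [Category.{v} C] [Regular C] {X Y Z T : C}

theorem exists_strongEpi_lift (q : X ⟶ Y) [StrongEpi q] (y : T ⟶ Y) :
    ∃ (S : C) (e : S ⟶ T) (x : S ⟶ X), StrongEpi e ∧ x ≫ q = e ≫ y := by
  have : IsRegularEpi q := inferInstance
  exact ⟨_, pullback.fst y q, pullback.snd y q, inferInstance, pullback.condition.symm⟩

theorem exists_desc_of_strongEpi (q : X ⟶ Y) [StrongEpi q] (f : X ⟶ Z)
    (h : ∀ ⦃T : C⦄ (x y : T ⟶ X), x ≫ q = y ≫ q → x ≫ f = y ≫ f) : ∃ g : Y ⟶ Z, q ≫ g = f :=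
  have : IsRegularEpi q := inferInstance
  IsRegularEpi.exists_of_isKernelPair q (IsKernelPair.of_hasPullback q) f
    (h _ _ pullback.condition)

theorem factors_imageSubobject_iff (f : X ⟶ Y) (y : T ⟶ Y) :
    (imageSubobject f).Factors y ↔
      ∃ (S : C) (e : S ⟶ T) (x : S ⟶ X), StrongEpi e ∧ x ≫ f = e ≫ y := by
  constructor
  · intro h
    have : StrongEpi (factorThruImageSubobject f) := strongEpi_comp _ _
    obtain ⟨S, e, x, he, hx⟩ :=
      exists_strongEpi_lift (factorThruImageSubobject f) ((imageSubobject f).factorThru y h)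
    exact ⟨S, e, x, he, by simpa using hx =≫ (imageSubobject f).arrow⟩
  · rintro ⟨S, e, x, he, hx⟩
    exact factors_of_strongEpi_comp (hx ▸ imageSubobject_factors_comp_self f x)

instance strongEpi_prod_map_id (f : X ⟶ Y) [StrongEpi f] : StrongEpi (prod.map f (𝟙 Z)) := by
  have hf : IsRegularEpi f := inferInstance
  have : IsRegularEpi (prod.map f (𝟙 Z)) :=
    Regular.regularEpiIsStableUnderBaseChange.of_isPullback
      (IsPullback.of_prod_fst_with_id f Z) hf
  infer_instance

instance strongEpi_prod_map {X' Y' : C} (f : X ⟶ Y) (g : X' ⟶ Y') [StrongEpi f] [StrongEpi g] :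
    StrongEpi (prod.map f g) := by
  have h : prod.map f g = prod.map f (𝟙 X') ≫
      ((prod.braiding Y X').hom ≫ prod.map g (𝟙 Y)) ≫ (prod.braiding Y' Y).hom := by
    ext <;> simp
  rw [h]
  have := strongEpi_comp (prod.braiding Y X').hom (prod.map g (𝟙 Y))
  have := strongEpi_comp ((prod.braiding Y X').hom ≫ prod.map g (𝟙 Y)) (prod.braiding Y' Y).hom
  exact strongEpi_comp _ _

theorem related_directImage {q : X ⟶ Y} {R : Subobject (X ⨯ X)} {x y : T ⟶ X}
    (h : Related R x y) : Related (directImage q R) (x ≫ q) (y ≫ q) := by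
  have := imageSubobject_factors_comp_self (R.arrow ≫ prod.map q q) (R.factorThru _ h)
  rwa [Subobject.factorThru_arrow_assoc, prod.lift_map] at this

theorem related_directImage_iff {q : X ⟶ Y} {R : Subobject (X ⨯ X)} {u v : T ⟶ Y} :
    Related (directImage q R) u v ↔ ∃ (S : C) (e : S ⟶ T) (x y : S ⟶ X), StrongEpi e ∧
      Related R x y ∧ x ≫ q = e ≫ u ∧ y ≫ q = e ≫ v := by
  constructor
  · intro h
    obtain ⟨S, e, r, he, hr⟩ := (factors_imageSubobject_iff _ _).1 h
    exact ⟨S, e, r ≫ relFst R, r ≫ relSnd R, he, factors_lift_arrow R r,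
      by simpa using hr =≫ prod.fst, by simpa using hr =≫ prod.snd⟩
  · rintro ⟨S, e, x, y, he, hr, hx, hy⟩
    refine factors_of_strongEpi_comp (e := e) ?_
    rw [prod.comp_lift, ← hx, ← hy]
    exact related_directImage hr

theorem IsEquivRel.directImage [Maltsev C] (q : X ⟶ Y) [StrongEpi q] {R : Subobject (X ⨯ X)}
    (hR : IsEquivRel R) : IsEquivRel (directImage q R) :=
  isEquivRel_of_related_id (related_directImage_iff.2
    ⟨X, q, 𝟙 X, 𝟙 X, inferInstance, hR.refl _, by simp, by simp⟩)

theorem isDiscrete_of_strongEpi (q : X ⟶ Y) [StrongEpi q] {R : Subobject (Y ⨯ Y)}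
    (h : ∀ ⦃T : C⦄ (x y : T ⟶ X), Related R (x ≫ q) (y ≫ q) → x ≫ q = y ≫ q) :
    IsDiscrete R := by
  intro T u v huv
  obtain ⟨S, e, x, he, hx⟩ := exists_strongEpi_lift q u
  obtain ⟨S', e', y, he', hy⟩ := exists_strongEpi_lift q (e ≫ v)
  have hx' : (e' ≫ x) ≫ q = (e' ≫ e) ≫ u := by simp [hx]
  have hy' : y ≫ q = (e' ≫ e) ≫ v := by simp [hy]
  have hxy : (e' ≫ x) ≫ q = y ≫ q :=
    h _ _ (by rw [hx', hy']; exact factors_lift_comp huv _)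
  have := epi_comp e' e
  rwa [hx', hy', cancel_epi] at hxy

end Regular

section KernelPair

variable {C : Type u} [Category.{v} C] {X Y T : C} {q : X ⟶ Y}

theorem related_iff_of_isKernelPair [HasFiniteLimits C] {K : Subobject (X ⨯ X)}
    (hK : IsKernelPair q (relFst K) (relSnd K)) {x y : T ⟶ X} :
    Related K x y ↔ x ≫ q = y ≫ q := by
  constructor
  · intro hxy
    simpa using K.factorThru _ hxy ≫= hK.w
  · intro hxy
    simpa only [hK.lift_fst, hK.lift_snd] using factors_lift_arrow K (hK.lift x y hxy)

theorem related_of_directImage [Regular C] {K R : Subobject (X ⨯ X)}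
    (hK : IsKernelPair q (relFst K) (relSnd K)) (hR : IsEquivRel R) (hKR : K ≤ R) {x y : T ⟶ X}
    (h : Related (directImage q R) (x ≫ q) (y ≫ q)) : Related R x y := by
  obtain ⟨S, e, x', y', he, hxy', hx, hy⟩ := related_directImage_iff.1 h
  have related_of_eq : ∀ {z w : S ⟶ X}, z ≫ q = w ≫ q → Related R z w := fun hzw =>
    Subobject.factors_of_le _ hKR ((related_iff_of_isKernelPair hK).2 hzw)
  refine factors_of_strongEpi_comp (e := e) ?_
  rw [prod.comp_lift]
  exact hR.trans (related_of_eq (by simp [hx])) (hR.trans hxy' (related_of_eq (by simp [hy])))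

theorem IsEquivRel.exists_quotient [BarrExact C] {R : Subobject (X ⨯ X)} (hR : IsEquivRel R) :
    ∃ (Y : C) (q : X ⟶ Y), IsRegularEpi q ∧ IsKernelPair q (relFst R) (relSnd R) := by
  obtain ⟨⟨E⟩⟩ := BarrExact.effective _ _ hR
  exact ⟨E.B, E.π, inferInstance, E.isKernelPair⟩

end KernelPair

section Smith

variable {C : Type u} [Category.{v} C] [Maltsev C] {X : C} {R S T : Subobject (X ⨯ X)}

theorem centraliseModulo_inf [BarrExact C] (hR : IsEquivRel R) (hS : IsEquivRel S) :
    CentraliseModulo R S (R ⊓ S) := by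
  obtain ⟨Y, q, hq, hK⟩ := (hR.inf hS).exists_quotient
  refine ⟨Y, q, hq, hK, centralise_of_isDiscrete_inf (hR.directImage q) (hS.directImage q)
    (isDiscrete_of_strongEpi q fun T x y hxy => ?_)⟩
  obtain ⟨hxyR, hxyS⟩ := related_inf_iff.1 hxy
  exact (related_iff_of_isKernelPair hK).1 (related_inf_iff.2
    ⟨related_of_directImage hK hR inf_le_left hxyR, related_of_directImage hK hS inf_le_right hxyS⟩)

theorem inf_le_of_centraliseModulo [Regular C]
    (hC : ∀ G : InternalGroupoid C, IsEquivalenceRelation G.d G.c) (hR : IsEquivRel R)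
    (hS : IsEquivRel S) (h : CentraliseModulo R S T) : R ⊓ S ≤ T := by
  obtain ⟨Y, q, hq, hK, hc⟩ := h
  refine le_of_related fun U x y hxy => (related_iff_of_isKernelPair hK).2 ?_
  obtain ⟨hxyR, hxyS⟩ := related_inf_iff.1 hxy
  exact hc.isDiscrete_inf hC (hR.directImage q) (hS.directImage q)
    (related_inf_iff.2 ⟨related_directImage hxyR, related_directImage hxyS⟩)

theorem isSmithCommutator_inf [BarrExact C]
    (hC : ∀ G : InternalGroupoid C, IsEquivalenceRelation G.d G.c) (hR : IsEquivRel R)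
    (hS : IsEquivRel S) : IsSmithCommutator R S (R ⊓ S) :=
  ⟨⟨hR.inf hS, centraliseModulo_inf hR hS⟩,
    fun _ hT => inf_le_of_centraliseModulo hC hR hS hT.2⟩

end Smith

section Huq

variable {C : Type u} [Category.{v} C] [HasZeroMorphisms C]

section HasBinaryProducts

variable [HasBinaryProducts C] {K L D : C} {k : K ⟶ D} {l : L ⟶ D}

theorem huqCommute_zero_left (l : L ⟶ D) : HuqCommute (0 : K ⟶ D) l :=
  ⟨prod.snd ≫ l, by simp, by simp⟩

theorem huqCommute_zero_right (k : K ⟶ D) : HuqCommute k (0 : L ⟶ D) :=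
  ⟨prod.fst ≫ k, by simp, by simp⟩

theorem HuqCommute.precomp (h : HuqCommute k l) {K' L' : C} (i : K' ⟶ K) (j : L' ⟶ L) :
    HuqCommute (i ≫ k) (j ≫ l) := by
  obtain ⟨φ, rfl, rfl⟩ := h
  exact ⟨prod.map i j ≫ φ, by simp [prod.lift_map_assoc, prod.comp_lift_assoc],
    by simp [prod.lift_map_assoc, prod.comp_lift_assoc]⟩

end HasBinaryProducts

section Maltsev

variable [Maltsev C] {A B Z : C}

theorem eq_top_of_factors_axes {M : Subobject (A ⨯ B)} (hA : M.Factors (prod.lift (𝟙 A) 0))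
    (hB : M.Factors (prod.lift 0 (𝟙 B))) : M = ⊤ := by
  have hP := IsPullback.of_hasBinaryProduct' A B
  refine eq_top_of_factors_sections hP (s := 0) (t := 0) (Subsingleton.elim _ _)
    (Subsingleton.elim _ _) ?_ ?_
  · convert hA
    apply hP.hom_ext <;> simp
  · convert hB
    apply hP.hom_ext <;> simp

theorem hom_ext_of_axes {f g : A ⨯ B ⟶ Z}
    (hA : prod.lift (𝟙 A) 0 ≫ f = prod.lift (𝟙 A) 0 ≫ g)
    (hB : prod.lift 0 (𝟙 B) ≫ f = prod.lift 0 (𝟙 B) ≫ g) : f = g := by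
  have h : equalizerSubobject f g = ⊤ := eq_top_of_factors_axes
    ((equalizerSubobject_factors_iff _ _ _).2 hA) ((equalizerSubobject_factors_iff _ _ _).2 hB)
  simpa using (equalizerSubobject_factors_iff f g (𝟙 _)).1 (h ▸ Subobject.top_factors _)

theorem HuqCommute.of_comp_mono {D : C} {k : A ⟶ D} {l : B ⟶ D} (m : D ⟶ Z) [Mono m]
    (h : HuqCommute (k ≫ m) (l ≫ m)) : HuqCommute k l := by
  obtain ⟨φ, hk, hl⟩ := h
  have htop : (Subobject.pullback φ).obj (Subobject.mk m) = ⊤ := eq_top_of_factors_axes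
    ((pullback_factors_iff _ _ _).2 ((Subobject.mk_factors_iff _ _).2 ⟨k, hk.symm⟩))
    ((pullback_factors_iff _ _ _).2 ((Subobject.mk_factors_iff _ _).2 ⟨l, hl.symm⟩))
  obtain ⟨ψ, hψ⟩ : ∃ ψ, ψ ≫ m = 𝟙 _ ≫ φ := (Subobject.mk_factors_iff m _).1
    ((pullback_factors_iff _ _ (𝟙 _)).1 (htop ▸ Subobject.top_factors _))
  rw [Category.id_comp] at hψ
  exact ⟨ψ, by simp [← cancel_mono m, hψ, hk], by simp [← cancel_mono m, hψ, hl]⟩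

theorem HuqCommute.of_strongEpi_comp [Regular C] {K L : C} (e : A ⟶ K) (e' : B ⟶ L) [StrongEpi e]
    [StrongEpi e'] {k : K ⟶ Z} {l : L ⟶ Z} (h : HuqCommute (e ≫ k) (e' ≫ l)) :
    HuqCommute k l := by
  obtain ⟨φ, hk, hl⟩ := h
  have hk' {T : C} (x : T ⟶ A) : prod.lift x 0 ≫ φ = x ≫ e ≫ k := by
    simpa [prod.comp_lift_assoc] using x ≫= hk
  have hl' {T : C} (y : T ⟶ B) : prod.lift 0 y ≫ φ = y ≫ e' ≫ l := by
    simpa [prod.comp_lift_assoc] using y ≫= hl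
  have hφ : prod.map (pullback.fst e e) (pullback.fst e' e') ≫ φ =
      prod.map (pullback.snd e e) (pullback.snd e' e') ≫ φ := by
    apply hom_ext_of_axes
    · simp [prod.lift_map_assoc, hk', pullback.condition_assoc]
    · simp [prod.lift_map_assoc, hl', pullback.condition_assoc]
  obtain ⟨ψ, hψ⟩ := exists_desc_of_strongEpi (prod.map e e') φ fun T x y hxy => by
    have hfst : (x ≫ prod.fst) ≫ e = (y ≫ prod.fst) ≫ e := by simpa using hxy =≫ prod.fst
    have hsnd : (x ≫ prod.snd) ≫ e' = (y ≫ prod.snd) ≫ e' := by simpa using hxy =≫ prod.snd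
    have := prod.lift (pullback.lift _ _ hfst) (pullback.lift _ _ hsnd) ≫= hφ
    simpa [prod.lift_map_assoc, ← prod.comp_lift] using this
  have hψ' {T : C} (x : T ⟶ A) (y : T ⟶ B) :
      prod.lift (x ≫ e) (y ≫ e') ≫ ψ = prod.lift x y ≫ φ := by
    simp [← hψ, prod.lift_map_assoc]
  refine ⟨ψ, ?_, ?_⟩
  · simpa [← cancel_epi e, prod.comp_lift_assoc, hk'] using hψ' (𝟙 A) 0
  · simpa [← cancel_epi e', prod.comp_lift_assoc, hl'] using hψ' 0 (𝟙 B)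

theorem IsAbelianObject.isZero (hC : ∀ G : InternalGroupoid C, IsEquivalenceRelation G.d G.c)
    (hA : IsAbelianObject A) : IsZero A := by
  obtain ⟨φ, hl, hr⟩ := hA
  let G : MultiplicativeGraph C :=
    { G₀ := ⊤_ C
      G₁ := A
      d := terminal.from A
      c := terminal.from A
      e := 0
      comp := prod.lift (pullback.fst _ _) (pullback.snd _ _) ≫ φ
      e_d := Subsingleton.elim _ _
      e_c := Subsingleton.elim _ _
      comp_d := Subsingleton.elim _ _
      comp_c := Subsingleton.elim _ _
      id_comp := by simp [prod.comp_lift_assoc, hr]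
      comp_id := by simp [prod.comp_lift_assoc, hl] }
  have : JointlyMono₂ (terminal.from A) (terminal.from A) := G.jointlyMono₂ hC
  exact (IsZero.iff_id_eq_zero A).2 (JointlyMono₂.right_cancellation (p₁ := terminal.from A)
    (p₂ := terminal.from A) _ _ (Subsingleton.elim _ _) (Subsingleton.elim _ _))

theorem HuqCommute.isZero_inf (hC : ∀ G : InternalGroupoid C, IsEquivalenceRelation G.d G.c)
    {K L : Subobject A} (h : HuqCommute K.arrow L.arrow) :
    IsZero ((K ⊓ L : Subobject A) : C) := by
  have hinf := h.precomp (Subobject.ofLE (K ⊓ L) K inf_le_left)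
    (Subobject.ofLE (K ⊓ L) L inf_le_right)
  rw [Subobject.ofLE_arrow, Subobject.ofLE_arrow] at hinf
  exact IsAbelianObject.isZero hC (HuqCommute.of_comp_mono (K ⊓ L).arrow (by simpa using hinf))

end Maltsev

end Huq

section Higgins

variable {C : Type u} [Category.{v} C] [HasZeroMorphisms C]

section Maltsev

variable [Maltsev C] [Regular C] {A K L Z : C}

theorem strongEpi_of_axes {f : Z ⟶ K ⨯ L} {s : K ⟶ Z} {t : L ⟶ Z}
    (hs : s ≫ f = prod.lift (𝟙 K) 0) (ht : t ≫ f = prod.lift 0 (𝟙 L)) : StrongEpi f := by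
  have htop : imageSubobject f = ⊤ := eq_top_of_factors_axes
    (hs ▸ imageSubobject_factors_comp_self f s) (ht ▸ imageSubobject_factors_comp_self f t)
  obtain ⟨T, e, x, he, hx⟩ :=
    (factors_imageSubobject_iff f (𝟙 _)).1 (htop ▸ Subobject.top_factors _)
  have : StrongEpi (x ≫ f) := by rwa [hx, Category.comp_id]
  exact strongEpi_of_strongEpi x f

theorem huqCommute_of_factors {M : Subobject (A ⨯ (K ⨯ L))} {k : K ⟶ A} {l : L ⟶ A} {f : A ⟶ Z}
    (hk : M.Factors (prod.lift k (prod.lift (𝟙 K) 0)))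
    (hl : M.Factors (prod.lift l (prod.lift 0 (𝟙 L))))
    (hf : ∀ ⦃T : C⦄ (a b : T ⟶ A) (p : T ⟶ K ⨯ L), M.Factors (prod.lift a p) →
      M.Factors (prod.lift b p) → a ≫ f = b ≫ f) : HuqCommute (k ≫ f) (l ≫ f) := by
  have : StrongEpi (M.arrow ≫ prod.snd) := strongEpi_of_axes (s := M.factorThru _ hk)
    (t := M.factorThru _ hl) (by simp) (by simp)
  obtain ⟨φ, hφ⟩ := exists_desc_of_strongEpi (M.arrow ≫ prod.snd) (M.arrow ≫ prod.fst ≫ f)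
    fun T x y hxy => by
      have hx := factors_lift_arrow M x
      rw [hxy] at hx
      simpa using hf _ _ _ hx (factors_lift_arrow M y)
  exact ⟨φ, by simpa using M.factorThru _ hk ≫= hφ, by simpa using M.factorThru _ hl ≫= hφ⟩

end Maltsev

section BarrExact

variable [Maltsev C] [BarrExact C] {X : C}

theorem factors_id_zero_of_axes
    (hC : ∀ G : InternalGroupoid C, IsEquivalenceRelation G.d G.c)
    {M : Subobject (X ⨯ (X ⨯ X))} (h₁ : M.Factors (prod.lift (𝟙 X) (prod.lift (𝟙 X) 0)))
    (h₂ : M.Factors (prod.lift (𝟙 X) (prod.lift 0 (𝟙 X)))) :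
    M.Factors (prod.lift (𝟙 X) 0) := by
  -- Dividing `X` by the relation `x V y ↔ M(y, (x, 0))` gives an abelian, hence zero, object.
  let V : Subobject (X ⨯ X) :=
    (Subobject.pullback (prod.lift prod.snd (prod.lift prod.fst 0))).obj M
  have related_iff {T : C} (x y : T ⟶ X) :
      Related V x y ↔ M.Factors (prod.lift y (prod.lift x 0)) := by
    rw [Related, pullback_factors_iff]
    simp [prod.comp_lift]
  have hV : IsEquivRel V := isEquivRel_of_related_id ((related_iff _ _).2 h₁)
  obtain ⟨Q, q, hq, hK⟩ := hV.exists_quotient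
  have hqq : HuqCommute (𝟙 X ≫ q) (𝟙 X ≫ q) := huqCommute_of_factors h₁ h₂ fun T a b p ha hb => by
    have hbb : M.Factors (prod.lift b (prod.lift b 0)) := by
      simpa [prod.comp_lift] using factors_lift_comp h₁ b
    exact ((related_iff_of_isKernelPair hK).1
      ((related_iff b a).2 (difunctional ha hb hbb))).symm
  have hQ : IsZero Q := IsAbelianObject.isZero hC
    (HuqCommute.of_strongEpi_comp q q (by simpa using hqq))
  have h₀ := (related_iff 0 (𝟙 X)).1 ((related_iff_of_isKernelPair hK).2 (hQ.eq_of_tgt _ _))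
  rwa [show prod.lift (0 : X ⟶ X) 0 = 0 by ext <;> simp] at h₀

end BarrExact

section HasBinaryCoproducts

variable [HasBinaryCoproducts C]

/-- The canonical morphism `K ⨿ L ⟶ K ⨯ L`, whose kernel defines the Higgins commutator. -/
noncomputable def coprodToProd [HasBinaryProducts C] (K L : C) : K ⨿ L ⟶ K ⨯ L :=
  coprod.desc (prod.lift (𝟙 K) 0) (prod.lift 0 (𝟙 L))

theorem coprod_map_comp_coprodToProd [HasBinaryProducts C] {K L K' L' : C} (i : K ⟶ K')
    (j : L ⟶ L') : coprod.map i j ≫ coprodToProd K' L' = coprodToProd K L ≫ prod.map i j := by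
  apply coprod.hom_ext <;> simp [coprodToProd, prod.lift_map, prod.comp_lift]

theorem strongEpi_kernel_ι_comp_codiag [Maltsev C] [BarrExact C]
    (hC : ∀ G : InternalGroupoid C, IsEquivalenceRelation G.d G.c) (X : C) :
    StrongEpi (kernel.ι (coprodToProd X X) ≫ codiag X) := by
  let f : X ⨿ X ⟶ X ⨯ (X ⨯ X) := prod.lift (codiag X) (coprodToProd X X)
  have hinl : coprod.inl ≫ f = prod.lift (𝟙 X) (prod.lift (𝟙 X) 0) := by
    simp [f, coprodToProd, prod.comp_lift, coprod.inl_desc]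
  have hinr : coprod.inr ≫ f = prod.lift (𝟙 X) (prod.lift 0 (𝟙 X)) := by
    simp [f, coprodToProd, prod.comp_lift, coprod.inr_desc]
  obtain ⟨S, e, x, he, hx⟩ := (factors_imageSubobject_iff f _).1 (factors_id_zero_of_axes hC
    (hinl ▸ imageSubobject_factors_comp_self f coprod.inl)
    (hinr ▸ imageSubobject_factors_comp_self f coprod.inr))
  have hx₁ : x ≫ codiag X = e := by simpa [f] using hx =≫ prod.fst
  have hx₂ : x ≫ coprodToProd X X = 0 := by simpa [f] using hx =≫ prod.snd
  have : StrongEpi (kernel.lift _ x hx₂ ≫ kernel.ι (coprodToProd X X) ≫ codiag X) := by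
    rwa [kernel.lift_ι_assoc, hx₁]
  exact strongEpi_of_strongEpi (kernel.lift _ x hx₂) _

theorem inf_le_higginsCommutator [Maltsev C] [BarrExact C]
    (hC : ∀ G : InternalGroupoid C, IsEquivalenceRelation G.d G.c) {D : C} (K L : Subobject D) :
    K ⊓ L ≤ higginsCommutator K L := by
  -- By naturality `[K, L]` contains `[K ⊓ L, K ⊓ L]`, which is `K ⊓ L`.
  let I : Subobject D := K ⊓ L
  let ι : (I : C) ⨿ (I : C) ⟶ (K : C) ⨿ (L : C) :=
    coprod.map (I.ofLE K inf_le_left) (I.ofLE L inf_le_right)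
  have hι : ι ≫ coprod.desc K.arrow L.arrow = codiag _ ≫ I.arrow := by
    apply coprod.hom_ext <;> simp [ι]
  have hker : (kernel.ι (coprodToProd (I : C) I) ≫ ι) ≫ coprodToProd (K : C) L = 0 := by
    simp [ι, coprod_map_comp_coprodToProd]
  have hcomm : kernel.lift _ _ hker ≫ kernel.ι (coprodToProd (K : C) L) ≫
      coprod.desc K.arrow L.arrow = (kernel.ι _ ≫ codiag _) ≫ I.arrow := by
    rw [kernel.lift_ι_assoc, Category.assoc, hι, Category.assoc]
  have := strongEpi_kernel_ι_comp_codiag hC (I : C)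
  apply Subobject.le_of_factors
  refine factors_of_strongEpi_comp (e := kernel.ι (coprodToProd (I : C) I) ≫ codiag _) ?_
  rw [← hcomm]
  exact imageSubobject_factors_comp_self _ _

theorem higginsCommutator_le_kernelSubobject [Regular C] {D E : C} {K L : Subobject D} {f : D ⟶ E}
    (h : HuqCommute (K.arrow ≫ f) (L.arrow ≫ f)) : higginsCommutator K L ≤ kernelSubobject f := by
  obtain ⟨φ, hK, hL⟩ := h
  have hφ : coprod.desc K.arrow L.arrow ≫ f = coprodToProd (K : C) L ≫ φ := by
    apply coprod.hom_ext <;> simp [coprodToProd, hK, hL]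
  have hker : (kernel.ι (coprodToProd (K : C) L) ≫ coprod.desc K.arrow L.arrow) ≫ f = 0 := by
    rw [Category.assoc, hφ, kernel.condition_assoc, zero_comp]
  exact imageSubobject_le _ _
    (Subobject.factorThru_arrow _ _ ((kernelSubobject_factors_iff f _).2 hker))

theorem higginsCommutator_le_inf [Regular C] {D : C} {K L : Subobject D}
    (hK : IsNormalSubobject K) (hL : IsNormalSubobject L) : higginsCommutator K L ≤ K ⊓ L := by
  obtain ⟨E, f, rfl⟩ := hK
  obtain ⟨E', g, rfl⟩ := hL
  apply le_inf <;> apply higginsCommutator_le_kernelSubobject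
  · rw [kernelSubobject_arrow_comp]
    exact huqCommute_zero_left _
  · rw [kernelSubobject_arrow_comp]
    exact huqCommute_zero_right _

end HasBinaryCoproducts

end Higgins

section SmithIsHuq

variable {C : Type u} [Category.{v} C] [HasZeroMorphisms C]

section HasFiniteLimits

variable [HasFiniteLimits C]

theorem isZero_pullback_zero {A B : C} {f : A ⟶ B}
    (hf : ∀ ⦃T : C⦄ (a : T ⟶ A), a ≫ f = 0 → a = 0) :
    IsZero (pullback (0 : ⊤_ C ⟶ B) f) := by
  rw [IsZero.iff_id_eq_zero]
  apply pullback.hom_ext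
  · exact Subsingleton.elim _ _
  · simpa using hf (pullback.snd _ _) (by simp [← pullback.condition])

theorem Protomodular.isIso_of_section (hC : Protomodular C) {A B : C} {f : A ⟶ B} {s : B ⟶ A}
    (hs : s ≫ f = 𝟙 B) (hf : ∀ ⦃T : C⦄ (a : T ⟶ A), a ≫ f = 0 → a = 0) : IsIso s := by
  refine hC (0 : ⊤_ C ⟶ B) (𝟙 B) (𝟙 B) f s (Category.comp_id _) hs s hs (Category.id_comp _) ?_
  exact (isZero_pullback_zero (f := 𝟙 B) (by simp)).isIso (isZero_pullback_zero hf) _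

theorem isDiscrete_of_isZero_normalisation (hC : Protomodular C) {X : C} {R : Subobject (X ⨯ X)}
    (hR : Related R (𝟙 X) (𝟙 X)) (h : IsZero (normalisation R : C)) : IsDiscrete R := by
  let δ : X ⟶ R := R.factorThru _ hR
  have hδ : IsIso δ := hC.isIso_of_section (f := relFst R) (by simp [δ]) fun T a ha => by
    have hfactors : (normalisation R).Factors (a ≫ relSnd R) := by
      rw [normalisation, pullback_factors_iff, prod.comp_lift, comp_zero, Category.comp_id, ← ha]
      exact factors_lift_arrow R a
    have hsnd : a ≫ relSnd R = 0 := by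
      rw [← (normalisation R).factorThru_arrow _ hfactors,
        h.eq_of_tgt ((normalisation R).factorThru _ hfactors) 0, zero_comp]
    exact JointlyMono₂.right_cancellation (p₁ := relFst R) (p₂ := relSnd R) _ _
      (by simpa using ha) (by simpa using hsnd)
  rw [isDiscrete_iff_relFst_eq_relSnd, ← cancel_epi δ]
  simp [δ]

theorem normalisation_inf {X : C} (R S : Subobject (X ⨯ X)) :
    normalisation (R ⊓ S) = normalisation R ⊓ normalisation S :=
  Subobject.inf_pullback _ _ _

end HasFiniteLimits

theorem smithIsHuq_of_protomodular [Maltsev C]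
    (hC : ∀ G : InternalGroupoid C, IsEquivalenceRelation G.d G.c) (hP : Protomodular C) :
    SmithIsHuq C := by
  intro X R S hR hS h
  refine centralise_of_isDiscrete_inf hR hS
    (isDiscrete_of_isZero_normalisation hP ((hR.inf hS).refl _) ?_)
  rw [normalisation_inf]
  exact h.isZero_inf hC

end SmithIsHuq

end SmithHuq

theorem mainTheorem9_general {C : Type u} [Category.{v} C] [SmithHuq.Maltsev C]
    (hC : ∀ G : SmithHuq.InternalGroupoid C, IsEquivalenceRelation G.d G.c) :
    (∀ [SmithHuq.BarrExact C] {X : C} (R S : Subobject (X ⨯ X)), SmithHuq.IsEquivRel R →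
      SmithHuq.IsEquivRel S → SmithHuq.IsSmithCommutator R S (R ⊓ S)) ∧
    ∀ [HasZeroMorphisms C],
      (∀ A : C, SmithHuq.IsAbelianObject A → IsZero A) ∧
      (∀ [SmithHuq.BarrExact C] [HasBinaryCoproducts C] {D : C} (K L : Subobject D),
        SmithHuq.IsNormalSubobject K → SmithHuq.IsNormalSubobject L →
          SmithHuq.higginsCommutator K L = K ⊓ L) ∧
      (∀ {X : C} (R S : Subobject (X ⨯ X)),
        SmithHuq.normalisation (R ⊓ S) = SmithHuq.normalisation R ⊓ SmithHuq.normalisation S) ∧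
      (SmithHuq.Protomodular C → SmithHuq.SmithIsHuq C) :=
  ⟨fun _ _ hR hS => SmithHuq.isSmithCommutator_inf hC hR hS,
    fun _ hA => SmithHuq.IsAbelianObject.isZero hC hA,
    fun K L hK hL => le_antisymm (SmithHuq.higginsCommutator_le_inf hK hL)
      (SmithHuq.inf_le_higginsCommutator hC K L),
    SmithHuq.normalisation_inf,
    SmithHuq.smithIsHuq_of_protomodular hC⟩

theorem mainTheorem9 {C : Type u} [Category.{v} C] [SmithHuq.Arithmetical C] :
    -- Smith commutators of equivalence relations are intersections
    (∀ {X : C} (R S : Subobject (X ⨯ X)), SmithHuq.IsEquivRel R → SmithHuq.IsEquivRel S →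
      SmithHuq.IsSmithCommutator R S (R ⊓ S)) ∧
    ∀ [HasZeroObject C] [HasZeroMorphisms C],
      -- the only abelian object is the zero object
      (∀ A : C, SmithHuq.IsAbelianObject A → IsZero A) ∧
      ∀ [HasBinaryCoproducts C],
        -- Higgins commutators of normal subobjects are intersections
        (∀ {D : C} (K L : Subobject D), SmithHuq.IsNormalSubobject K →
          SmithHuq.IsNormalSubobject L → SmithHuq.higginsCommutator K L = K ⊓ L) ∧
        -- normalisation preserves intersections
        (∀ {X : C} (R S : Subobject (X ⨯ X)), SmithHuq.IsEquivRel R → SmithHuq.IsEquivRel S →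
          SmithHuq.normalisation (R ⊓ S) = SmithHuq.normalisation R ⊓ SmithHuq.normalisation S) ∧
        -- the Smith is Huq condition
        (SmithHuq.Protomodular C → SmithHuq.SmithIsHuq C) := by
  obtain ⟨hSmith, hpointed⟩ := mainTheorem9_general (C := C) SmithHuq.Arithmetical.groupoid
  refine ⟨hSmith, fun {_ _} => ?_⟩
  obtain ⟨habelian, hHiggins, hnormalisation, hSmithIsHuq⟩ := hpointed
  exact ⟨habelian, hHiggins, fun R S _ _ => hnormalisation R S, hSmithIsHuq⟩
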